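/- Let $n\ge 2$ be an integer and let $m=2^{n-1}$. Let $d_1,\dots,d_m\in\mathbb F_2^n$ be nonzero vectors, not necessarily distinct, such that $\sum_{i=1}^m d_i=0$. Suppose that the number of distinct values among $d_1,\dots,d_m$ is at most $n-2\log_2 n-1$. Then $\mathbb F_2^n$ can be partitioned into $m$ pairwise disjoint pairs $\{a_i,b_i\}$ $(1\le i\le m)$ such that $a_i-b_i=d_i$ for every $1\le i\le m$. -/

import Mathlib

/-! Let `t` be the number of distinct differences. By pigeonhole some value `v` occurs at least `t *
2 ^ t` times. The differences span a subspace `W` with at most `2 ^ t` elements, and each coset of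
`W` is filled separately, with the copies of `v` as padding: a set invariant under translation by
`v` splits into pairs of difference `v`. Let `T` be the set of values other than `v` of odd
multiplicity; the rest of the non-`v` differences then have even multiplicities. Since the total sum
is zero, parity gives `∑ s ∈ T, (s + v) = 0`, so `T` splits into minimal subsets `A` with this
property. Each `A` is realized in one coset by a closed path with steps `s + v`, together with its
translate by `v`; a suitable order of `A` keeps the path simple modulo `v`
(`exists_ordering_of_minimal`, `Realizes.of_minimal`). An even number of copies of `u` fits beside
copies of `v` by means of cosets of `{0, u, v, u + v}`. The supply of `v` suffices for all cosets
needing padding (`Realizes.blocks`). -/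

/-- `Realizes M D` means that the multiset `M` can be split into pairs whose differences form `D`. -/
def Realizes {V : Type*} [AddCommGroup V] (M D : Multiset V) : Prop :=
  ∃ P : Multiset (V × V), P.map Prod.fst + P.map Prod.snd = M ∧ P.map (fun p => p.1 - p.2) = D

/-! ### Multiset pairings and translation-invariant sets -/

namespace Realizes

section AddCommGroup

variable {V : Type*} [AddCommGroup V]

theorem zero : Realizes (0 : Multiset V) 0 := ⟨0, by simp, by simp⟩

theorem add {M M' D D' : Multiset V} (h : Realizes M D) (h' : Realizes M' D') :
    Realizes (M + M') (D + D') := by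
  obtain ⟨P, rfl, rfl⟩ := h
  obtain ⟨Q, rfl, rfl⟩ := h'
  exact ⟨P + Q, by simp only [Multiset.map_add]; exact add_add_add_comm .., by simp⟩

theorem card_eq {M D : Multiset V} (h : Realizes M D) :
    Multiset.card M = 2 * Multiset.card D := by
  obtain ⟨P, rfl, rfl⟩ := h
  simp [two_mul]

theorem exists_pairing {ι : Type*} [Fintype ι] {M : Multiset V} {d : ι → V}
    (h : Realizes M (Finset.univ.val.map d)) :
    ∃ a b : ι → V, Finset.univ.val.map a + Finset.univ.val.map b = M ∧ ∀ i, a i - b i = d i := by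
  obtain ⟨P, hM, hD⟩ := h
  have key : ∀ (s : Multiset ι) (P : Multiset (V × V)), s.Nodup →
      P.map (fun p => p.1 - p.2) = s.map d →
      ∃ f : ι → V × V, s.map f = P ∧ ∀ i ∈ s, (f i).1 - (f i).2 = d i := by
    classical
    intro s
    induction s using Multiset.induction_on with
    | empty =>
      intro P _ hP
      have : P = 0 := by simpa using hP
      exact ⟨fun _ => 0, by simp [this], by simp⟩
    | cons i s ih =>
      intro P hs hP
      rw [Multiset.nodup_cons] at hs
      have hi : d i ∈ P.map (fun p => p.1 - p.2) := by rw [hP]; simp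
      obtain ⟨p, hp, hpd⟩ := Multiset.mem_map.1 hi
      obtain ⟨Q, rfl⟩ := Multiset.exists_cons_of_mem hp
      rw [Multiset.map_cons, Multiset.map_cons, hpd, Multiset.cons_inj_right] at hP
      obtain ⟨f, hf, hfd⟩ := ih Q hs.2 hP
      refine ⟨Function.update f i p, ?_, ?_⟩
      · rw [Multiset.map_cons, Function.update_self, ← hf]
        congr 1
        refine Multiset.map_congr rfl fun j hj => ?_
        rw [Function.update_of_ne]
        rintro rfl
        exact hs.1 hj
      · intro j hj
        by_cases hji : j = i
        · subst hji
          simpa using hpd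
        · rw [Function.update_of_ne hji]
          exact hfd j ((Multiset.mem_cons.1 hj).resolve_left hji)
  obtain ⟨f, hf, hfd⟩ := key _ P Finset.univ.nodup hD
  refine ⟨fun i => (f i).1, fun i => (f i).2, ?_, fun i => hfd i (Finset.mem_univ i)⟩
  rw [← hM, ← hf]
  simp

end AddCommGroup

variable {V : Type*} [AddCommGroup V] [Module (ZMod 2) V]

theorem pair (x u : V) : Realizes ({x} + {x + u}) ({u} : Multiset V) :=
  ⟨{(x, x + u)}, by simp, by simp [ZModModule.neg_eq_self]⟩

variable [DecidableEq V]

theorem replicate_of_invariant {v : V} (hv : v ≠ 0) :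
    ∀ (k : ℕ) (X : Finset V), (∀ x ∈ X, x + v ∈ X) → X.card = 2 * k →
      Realizes X.val (Multiset.replicate k v) := by
  intro k
  induction k with
  | zero =>
    intro X _ hc
    obtain rfl : X = ∅ := by simpa using hc
    simpa using zero
  | succ k ih =>
    intro X hX hc
    obtain ⟨x, hx⟩ : X.Nonempty := Finset.card_pos.1 (by omega)
    have hxv : x ≠ x + v := by simpa using hv
    have hsub : ({x, x + v} : Finset V) ⊆ X := by
      simp [Finset.insert_subset_iff, hx, hX x hx]
    have hr := ih (X \ {x, x + v}) (by
      intro y hy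
      simp only [Finset.mem_sdiff, Finset.mem_insert, Finset.mem_singleton, not_or] at hy ⊢
      refine ⟨hX y hy.1, fun h => hy.2.2 ?_, fun h => hy.2.1 (by simpa using h)⟩
      rw [← h, add_assoc, ZModModule.add_self, add_zero])
      (by rw [Finset.card_sdiff_of_subset hsub, Finset.card_pair hxv]; omega)
    have h2 := hr.add (pair x v)
    have e : (X \ {x, x + v}).val + ({x} + {x + v}) = X.val := by
      have : ({x} + {x + v} : Multiset V) = ({x, x + v} : Finset V).val := by
        rw [Finset.insert_val_of_notMem (by simpa using hv)]
        rfl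
      rw [this, Finset.sdiff_val, tsub_add_cancel_of_le (Finset.val_le_iff.2 hsub)]
    rw [e] at h2
    rwa [add_comm, Multiset.singleton_add, ← Multiset.replicate_succ] at h2

/-- Cosets of `{0, u, v, u + v}` can be removed one at a time, and each splits into two pairs of
difference `u` or two of difference `v`; hence the even multiplicities. -/
theorem replicate_add_replicate_of_invariant {u v : V} (hu : u ≠ 0) (hv : v ≠ 0) (huv : u ≠ v) :
    ∀ (a b : ℕ) (X : Finset V), (∀ x ∈ X, x + u ∈ X) → (∀ x ∈ X, x + v ∈ X) →
      X.card = 4 * (a + b) →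
      Realizes X.val (Multiset.replicate (2 * a) u + Multiset.replicate (2 * b) v) := by
  intro a
  induction a with
  | zero =>
    intro b X _ hX hc
    simpa using replicate_of_invariant hv (2 * b) X hX (by omega)
  | succ a ih =>
    intro b X hXu hXv hc
    obtain ⟨x, hx⟩ : X.Nonempty := Finset.card_pos.1 (by omega)
    have huv' : u + v ≠ 0 := by
      rwa [Ne, ← ZModModule.sub_eq_add, sub_eq_zero]
    set Y : Finset V := {x, x + u, x + v, x + v + u} with hY
    have hYc : Y.card = 4 := by
      have h1 : x ∉ ({x + u, x + v, x + v + u} : Finset V) := by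
        simp [hu, hv, add_assoc, add_comm v u, huv']
      have h2 : x + u ∉ ({x + v, x + v + u} : Finset V) := by
        simp [huv, add_assoc, hv]
      have h3 : x + v ∉ ({x + v + u} : Finset V) := by simp [hu]
      rw [hY, Finset.card_insert_of_notMem h1, Finset.card_insert_of_notMem h2,
        Finset.card_insert_of_notMem h3, Finset.card_singleton]
    have hsub : Y ⊆ X := by
      simp [hY, Finset.insert_subset_iff, hx, hXu x hx, hXv x hx, hXu _ (hXv x hx)]
    have hYu : ∀ y ∈ Y, y + u ∈ Y := by
      intro y hy
      simp only [hY, Finset.mem_insert, Finset.mem_singleton] at hy ⊢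
      rcases hy with rfl | rfl | rfl | rfl <;> simp [add_assoc, ZModModule.add_self]
    have hYv : ∀ y ∈ Y, y + v ∈ Y := by
      intro y hy
      simp only [hY, Finset.mem_insert, Finset.mem_singleton] at hy ⊢
      rcases hy with rfl | rfl | rfl | rfl <;>
        simp [add_assoc, add_comm v u, ZModModule.add_self]
    have inv : ∀ w : V, (∀ x ∈ X, x + w ∈ X) → (∀ y ∈ Y, y + w ∈ Y) →
        ∀ x ∈ X \ Y, x + w ∈ X \ Y := by
      intro w h1 h2 z hz
      rw [Finset.mem_sdiff] at hz ⊢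
      refine ⟨h1 z hz.1, fun h => hz.2 ?_⟩
      have := h2 _ h
      rwa [add_assoc, ZModModule.add_self, add_zero] at this
    have h1 := ih b (X \ Y) (inv u hXu hYu) (inv v hXv hYv)
      (by rw [Finset.card_sdiff_of_subset hsub, hYc]; omega)
    have h2 := h1.add (replicate_of_invariant hu 2 Y hYu (by omega))
    rw [Finset.sdiff_val, tsub_add_cancel_of_le (Finset.val_le_iff.2 hsub)] at h2
    have e : Multiset.replicate (2 * (a + 1)) u =
        Multiset.replicate (2 * a) u + Multiset.replicate 2 u := by
      rw [← Multiset.replicate_add]; rfl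
    rw [e]
    rwa [add_right_comm] at h2

end Realizes

/-! ### Paths modulo `v` and orderings of minimal zero-sum sets -/

section Path

variable {V : Type*} [AddCommGroup V]

/-- The list of the partial sums of `l`, each step shifted by `v`, starting at `x` and without the
last one. -/
def shiftedPath (v : V) : V → List V → List V
  | _, [] => []
  | x, s :: l => x :: shiftedPath v (x + (s + v)) l

theorem exists_prefix_of_mem_shiftedPath {v y : V} {l : List V} :
    ∀ {x : V}, y ∈ shiftedPath v x l →
      ∃ m, m <+: l ∧ m ≠ l ∧ y = x + (m.map (· + v)).sum := by
  induction l with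
  | nil => intro x h; simp [shiftedPath] at h
  | cons s l ih =>
    intro x h
    rw [shiftedPath, List.mem_cons] at h
    rcases h with rfl | h
    · exact ⟨[], by simp, by simp, by simp⟩
    · obtain ⟨m, hm, hne, rfl⟩ := ih h
      exact ⟨s :: m, by simpa using hm, by simpa using hne, by simp [add_assoc]⟩

theorem mem_of_mem_shiftedPath {v : V} {X : Finset V} {l : List V} (hv : ∀ x ∈ X, x + v ∈ X) :
    ∀ {x y : V}, x ∈ X → (∀ s ∈ l, ∀ x ∈ X, x + s ∈ X) → y ∈ shiftedPath v x l → y ∈ X := by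
  induction l with
  | nil => intro x y _ _ h; simp [shiftedPath] at h
  | cons s l ih =>
    intro x y hx hl h
    rw [shiftedPath, List.mem_cons] at h
    rcases h with rfl | h
    · exact hx
    · refine ih ?_ (fun s hs => hl s (by simp [hs])) h
      rw [← add_assoc]
      exact hv _ (hl s (by simp) x hx)

variable [Module (ZMod 2) V]

/-- Pair each path point `y` with `y + s`, which is the next path point translated by `v`. The pairs
thus cover the path and its translate, except that the translate is advanced by one step; the two
singletons correct this and cancel when the path closes. -/
theorem Realizes.of_shiftedPath (v : V) (l : List V) :
    ∀ x : V, ∃ M, Realizes M (l : Multiset V) ∧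
      M + {x + v} = (shiftedPath v x l : Multiset V) +
        (shiftedPath v x l : Multiset V).map (· + v) + {x + (l.map (· + v)).sum + v} := by
  induction l with
  | nil => intro x; exact ⟨0, Realizes.zero, by simp [_root_.shiftedPath]⟩
  | cons s l ih =>
    intro x
    obtain ⟨M, hM, e⟩ := ih (x + (s + v))
    refine ⟨M + ({x} + {x + s}), ?_, ?_⟩
    · have := hM.add (Realizes.pair x s)
      rwa [← Multiset.cons_coe, ← Multiset.singleton_add, add_comm ({s} : Multiset V)]
    · have e1 : x + s = x + (s + v) + v := by
        rw [← add_assoc, add_assoc _ v v, ZModModule.add_self, add_zero]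
      have e2 : M + ({x} + {x + s}) + {x + v} = (M + {x + (s + v) + v}) + ({x} + {x + v}) := by
        rw [e1]; abel
      rw [e2, e, _root_.shiftedPath, ← Multiset.cons_coe, ← Multiset.singleton_add,
        Multiset.map_add, Multiset.map_singleton, List.map_cons, List.sum_cons, ← add_assoc x]
      abel_nf

/-- Two path points differ by the sum over an infix, so they are distinct modulo `v` when that sum
is neither `0` nor `v`. The whole list may be exempted because the endpoint is not in the path. -/
theorem nodup_shiftedPath {v : V} (hv : v ≠ 0) {l : List V} :
    (∀ m, m <:+: l → m ≠ [] → m ≠ l →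
      (m.map (· + v)).sum ≠ 0 ∧ (m.map (· + v)).sum ≠ v) →
    ∀ x : V, ((shiftedPath v x l : Multiset V) +
        (shiftedPath v x l : Multiset V).map (· + v)).Nodup := by
  induction l with
  | nil => intro _ x; simp [shiftedPath]
  | cons s l ih =>
    intro h x
    have hr := ih (fun m hm hne _ => h m (hm.trans (List.suffix_cons s l).isInfix) hne (by
      rintro rfl
      have := hm.length_le
      simp at this)) (x + (s + v))
    have hx : ∀ y ∈ shiftedPath v (x + (s + v)) l, x ≠ y ∧ x ≠ y + v := by
      intro y hy
      obtain ⟨m, hm, hne, rfl⟩ := exists_prefix_of_mem_shiftedPath hy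
      have := h (s :: m) (by
        have : s :: m <+: s :: l := by simpa using hm
        exact this.isInfix) (by simp) (by simpa using hne)
      rw [List.map_cons, List.sum_cons] at this
      refine ⟨fun e => this.1 ?_, fun e => this.2 ?_⟩
      · rw [add_assoc] at e
        simpa using e
      · rw [add_assoc, add_assoc] at e
        have e' : s + v + (List.map (· + v) m).sum + v = 0 := by simpa [add_assoc] using e
        rw [← ZModModule.sub_eq_add _ v, sub_eq_zero] at e'
        exact e'
    have e : ((shiftedPath v x (s :: l) : Multiset V) +
        (shiftedPath v x (s :: l) : Multiset V).map (· + v)) =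
        x ::ₘ (x + v) ::ₘ ((shiftedPath v (x + (s + v)) l : Multiset V) +
        (shiftedPath v (x + (s + v)) l : Multiset V).map (· + v)) := by
      rw [shiftedPath, ← Multiset.cons_coe, Multiset.map_cons]
      simp only [← Multiset.singleton_add]
      abel
    rw [e, Multiset.nodup_cons, Multiset.nodup_cons]
    refine ⟨?_, ?_, hr⟩
    · simp only [Multiset.mem_cons, Multiset.mem_add, Multiset.mem_map, Multiset.mem_coe]
      rintro (h1 | h1 | ⟨y, hy, h1⟩)
      · exact hv (by simpa using h1)
      · exact (hx x h1).1 rfl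
      · exact (hx y hy).2 h1.symm
    · simp only [Multiset.mem_add, Multiset.mem_map, Multiset.mem_coe]
      rintro (h1 | ⟨y, hy, h1⟩)
      · refine (hx _ h1).2 ?_
        rw [add_assoc, ZModModule.add_self, add_zero]
      · exact (hx y hy).1 (by simpa using h1.symm)

/-- Minimality rules out infix sums `0`. If `B` has sum `v`, so does `A \ B`, and no other subset
does; starting the list with alternating elements of the two makes neither of them contiguous. -/
theorem exists_ordering_of_minimal [DecidableEq V] {v : V} (hv : v ≠ 0) {A : Finset V}
    (hA0 : (0 : V) ∉ A) (hsum : ∑ s ∈ A, (s + v) = 0)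
    (hmin : ∀ B ⊆ A, ∑ s ∈ B, (s + v) = 0 → B = ∅ ∨ B = A) :
    ∃ l : List V, (l : Multiset V) = A.val ∧ ∀ m, m <:+: l → m ≠ [] → m ≠ l →
      (m.map (· + v)).sum ≠ 0 ∧ (m.map (· + v)).sum ≠ v := by
  have sum_eq : ∀ l : List V, (l : Multiset V) = A.val → ∀ m, m <:+: l →
      m.Nodup ∧ m.toFinset ⊆ A ∧ (m.map (· + v)).sum = ∑ s ∈ m.toFinset, (s + v) := by
    intro l hl m hm
    have hn : l.Nodup := by
      rw [← Multiset.coe_nodup, hl]; exact A.nodup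
    have hmn := hn.sublist hm.sublist
    refine ⟨hmn, ?_, (List.sum_toFinset _ hmn).symm⟩
    intro x hx
    rw [← Finset.mem_val, ← hl]
    exact hm.subset (by simpa using hx)
  have ne_zero : ∀ l : List V, (l : Multiset V) = A.val → ∀ m, m <:+: l → m ≠ [] → m ≠ l →
      (m.map (· + v)).sum ≠ 0 := by
    intro l hl m hm hne hnl h0
    obtain ⟨hmn, hs, he⟩ := sum_eq l hl m hm
    rw [he] at h0
    rcases hmin _ hs h0 with h | h
    · exact hne (by simpa using h)
    · refine hnl (hm.sublist.eq_of_length ?_)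
      rw [← List.toFinset_card_of_nodup hmn, h, Finset.card_def, ← hl, Multiset.coe_card]
  by_cases hB : ∃ B ⊆ A, ∑ s ∈ B, (s + v) = v
  · obtain ⟨B, hBA, hBv⟩ := hB
    -- The empty sum is not `v`, and a singleton sum `s + v = v` would force `s = 0`.
    have big : ∀ B ⊆ A, ∑ s ∈ B, (s + v) = v → 1 < B.card := by
      intro B hBA hBv
      by_contra hc
      have hc : B.card ≤ 1 := by omega
      rcases Finset.card_le_one_iff_subset_singleton.1 hc with ⟨b, hb⟩
      rcases Finset.subset_singleton_iff.1 hb with rfl | rfl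
      · exact hv (by simpa using hBv.symm)
      · have : b = 0 := by simpa using hBv
        exact hA0 (hBA (by simp [this]))
    have hcompl : ∑ s ∈ A \ B, (s + v) = v := by
      have := Finset.sum_sdiff (f := fun s => s + v) hBA
      rw [hsum, hBv, ← ZModModule.sub_eq_add, sub_eq_zero] at this
      exact this
    obtain ⟨b, hb, b', hb', hbb⟩ := Finset.one_lt_card.1 (big B hBA hBv)
    obtain ⟨a, ha, a', ha', haa⟩ := Finset.one_lt_card.1 (big _ Finset.sdiff_subset hcompl)
    have unique : ∀ C ⊆ A, ∑ s ∈ C, (s + v) = v → C = B ∨ C = A \ B := by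
      intro C hCA hCv
      -- In characteristic 2 the sum over a symmetric difference is the sum of the two sums, here `v
      -- + v = 0`; minimality then applies to it.
      have hz : ∑ s ∈ symmDiff B C, (s + v) = 0 := by
        have h1 := Finset.sum_sdiff (f := fun s => s + v) (Finset.inter_subset_left (s₁ := B) (s₂ := C))
        have h2 := Finset.sum_sdiff (f := fun s => s + v) (Finset.inter_subset_right (s₁ := B) (s₂ := C))
        rw [Finset.sdiff_inter_self_left, hBv] at h1
        rw [Finset.sdiff_inter_self_right, hCv] at h2
        rw [symmDiff_def, Finset.sup_eq_union, Finset.sum_union (disjoint_sdiff_sdiff)]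
        have h3 := h1.trans h2.symm
        rw [add_left_inj] at h3
        rw [h3, ZModModule.add_self]
      have hs : symmDiff B C ⊆ A := by
        intro x hx
        rw [Finset.mem_symmDiff] at hx
        rcases hx with hx | hx
        · exact hBA hx.1
        · exact hCA hx.1
      rcases hmin _ hs hz with h | h
      · left
        rw [← Finset.bot_eq_empty, symmDiff_eq_bot] at h
        exact h.symm
      · right
        ext x
        have := Finset.ext_iff.1 h x
        rw [Finset.mem_symmDiff] at this
        rw [Finset.mem_sdiff]
        have h1 := @hBA x
        have h2 := @hCA x
        tauto
    rw [Finset.mem_sdiff] at ha ha'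
    set R := A \ {b, a, b', a'} with hR
    have hba : b ≠ a := fun h => ha.2 (h ▸ hb)
    have hba' : b ≠ a' := fun h => ha'.2 (h ▸ hb)
    have hb'a : b' ≠ a := fun h => ha.2 (h ▸ hb')
    have hb'a' : b' ≠ a' := fun h => ha'.2 (h ▸ hb')
    have hl : ((b :: a :: b' :: a' :: R.toList : List V) : Multiset V) = A.val := by
      have hsub : ({b, a, b', a'} : Finset V) ⊆ A := by
        simp [Finset.insert_subset_iff, ha.1, ha'.1, hBA hb, hBA hb']
      have hval : ({b, a, b', a'} : Finset V).val = b ::ₘ a ::ₘ b' ::ₘ {a'} := by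
        rw [Finset.insert_val_of_notMem (by simp [hba, hbb, hba']),
          Finset.insert_val_of_notMem (by simp [hb'a.symm, haa]),
          Finset.insert_val_of_notMem (by simp [hb'a'])]
        rfl
      have : A.val = ({b, a, b', a'} : Finset V).val + R.val := by
        rw [hR, Finset.sdiff_val, add_tsub_cancel_of_le (Finset.val_le_iff.2 hsub)]
      rw [this, hval]
      simp [← Multiset.cons_coe]
    refine ⟨_, hl, fun m hm hne hnl => ⟨ne_zero _ hl m hm hne hnl, fun h => ?_⟩⟩
    obtain ⟨hmn, hs, he⟩ := sum_eq _ hl m hm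
    rw [he] at h
    have hn : (b :: a :: b' :: a' :: R.toList).Nodup := by
      rw [← Multiset.coe_nodup, hl]; exact A.nodup
    obtain ⟨p, q, hpq⟩ := hm
    have mem : ∀ x, x ∈ m ↔ x ∈ m.toFinset := by simp
    rcases unique _ hs h with h | h
    · have h1 : b ∈ m := by rw [mem, h]; exact hb
      have h2 : b' ∈ m := by rw [mem, h]; exact hb'
      have h3 : a ∉ m := by rw [mem, h]; exact ha.2
      rcases p with _ | ⟨y, p⟩
      · rcases m with _ | ⟨m₁, _ | ⟨m₂, m⟩⟩
        · simp at h1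
        · simp only [List.mem_singleton] at h1 h2
          exact hbb (h1.trans h2.symm)
        · simp only [List.nil_append, List.cons_append, List.cons.injEq] at hpq
          exact h3 (by simp [hpq.2.1])
      · simp only [List.cons_append, List.cons.injEq] at hpq
        refine (List.nodup_cons.1 hn).1 ?_
        rw [← hpq.2]
        simp [h1]
    · have h1 : a ∈ m := by rw [mem, h]; simpa using ha
      have h2 : a' ∈ m := by rw [mem, h]; simpa using ha'
      have h3 : b' ∉ m := by rw [mem, h]; simp [hb']
      have hb1 : b ∉ m := by rw [mem, h]; simp [hb]
      rcases p with _ | ⟨y, _ | ⟨z, p⟩⟩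
      · rcases m with _ | ⟨m₁, m⟩
        · simp at h1
        · simp only [List.nil_append, List.cons_append, List.cons.injEq] at hpq
          exact hb1 (by simp [hpq.1])
      · rcases m with _ | ⟨m₁, _ | ⟨m₂, m⟩⟩
        · simp at h1
        · simp only [List.mem_singleton] at h1 h2
          exact haa (h1.trans h2.symm)
        · simp only [List.nil_append, List.cons_append, List.cons.injEq] at hpq
          exact h3 (by simp [hpq.2.2.1])
      · simp only [List.cons_append, List.cons.injEq] at hpq
        refine (List.nodup_cons.1 (List.nodup_cons.1 hn).2).1 ?_
        rw [← hpq.2.2]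
        simp [h1]
  · push Not at hB
    refine ⟨A.toList, by simp, fun m hm hne hnl => ⟨ne_zero _ (by simp) m hm hne hnl, ?_⟩⟩
    obtain ⟨_, hs, he⟩ := sum_eq _ (by simp) m hm
    rw [he]
    exact hB _ hs

end Path

theorem Realizes.of_subset {V : Type*} [AddCommGroup V] [DecidableEq V] {X C : Finset V}
    {D E : Multiset V} (hCX : C ⊆ X) (hC : Realizes C.val D) (hX : Realizes (X \ C).val E) :
    Realizes X.val (D + E) := by
  have := hC.add hX
  rwa [Finset.sdiff_val, add_tsub_cancel_of_le (Finset.val_le_iff.2 hCX)] at this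

/-! ### Filling blocks one at a time -/

section Blocks

variable {V : Type*} [AddCommGroup V] [Module (ZMod 2) V] [DecidableEq V]

theorem Realizes.of_minimal {v : V} (hv : v ≠ 0) {A : Finset V} (hA0 : (0 : V) ∉ A)
    (hsum : ∑ s ∈ A, (s + v) = 0)
    (hmin : ∀ B ⊆ A, ∑ s ∈ B, (s + v) = 0 → B = ∅ ∨ B = A) {X : Finset V} (hX : X.Nonempty)
    (hXv : ∀ x ∈ X, x + v ∈ X) (hXA : ∀ s ∈ A, ∀ x ∈ X, x + s ∈ X) {k : ℕ}
    (hk : X.card = 2 * k) :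
    A.card ≤ k ∧ Realizes X.val (A.val + Multiset.replicate (k - A.card) v) := by
  obtain ⟨x, hx⟩ := hX
  obtain ⟨l, hl, hgood⟩ := exists_ordering_of_minimal hv hA0 hsum hmin
  have hn := nodup_shiftedPath hv hgood x
  obtain ⟨M, hM, e⟩ := Realizes.of_shiftedPath v l x
  have hlsum : (l.map (· + v)).sum = 0 := by
    rw [← hsum, Finset.sum, ← hl, Multiset.map_coe, Multiset.sum_coe]
  rw [hlsum, add_zero, add_left_inj] at e
  rw [hl] at hM
  rw [← e] at hn
  set C : Finset V := ⟨M, hn⟩ with hC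
  have hmem : ∀ y, y ∈ C ↔ y ∈ shiftedPath v x l ∨ ∃ z ∈ shiftedPath v x l, z + v = y := by
    intro y
    rw [← Finset.mem_val, hC]
    simp [e]
  have hpath : ∀ y ∈ shiftedPath v x l, y ∈ X := fun y hy =>
    mem_of_mem_shiftedPath hXv hx (fun s hs => hXA s (by
      rw [← Finset.mem_val, ← hl]; exact hs)) hy
  have hCX : C ⊆ X := by
    intro y hy
    rcases (hmem y).1 hy with h | ⟨z, hz, rfl⟩
    · exact hpath y h
    · exact hXv z (hpath z hz)
  have hCv : ∀ y ∈ C, y + v ∈ C := by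
    intro y hy
    rw [hmem]
    rcases (hmem y).1 hy with h | ⟨z, hz, rfl⟩
    · exact Or.inr ⟨y, h, rfl⟩
    · left
      rwa [add_assoc, ZModModule.add_self, add_zero]
  have hcard : C.card = 2 * A.card := hM.card_eq
  have hle := Finset.card_le_card hCX
  refine ⟨by omega, Realizes.of_subset hCX hM ?_⟩
  refine Realizes.replicate_of_invariant hv _ _ ?_ ?_
  · intro y hy
    rw [Finset.mem_sdiff] at hy ⊢
    refine ⟨hXv y hy.1, fun h => hy.2 ?_⟩
    have := hCv _ h
    rwa [add_assoc, ZModModule.add_self, add_zero] at this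
  · rw [Finset.card_sdiff_of_subset hCX]
    omega

theorem exists_minimal_sum_eq_zero {ι M : Type*} [DecidableEq ι] [AddCommMonoid M] (f : ι → M)
    {T : Finset ι} (hT : T.Nonempty) (h0 : ∑ s ∈ T, f s = 0) :
    ∃ A ⊆ T, A.Nonempty ∧ ∑ s ∈ A, f s = 0 ∧
      ∀ B ⊆ A, ∑ s ∈ B, f s = 0 → B = ∅ ∨ B = A := by
  induction T using Finset.strongInduction with
  | H T ih =>
    by_cases h : ∃ B ⊆ T, ∑ s ∈ B, f s = 0 ∧ B.Nonempty ∧ B ≠ T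
    · obtain ⟨B, hBT, hB0, hBn, hne⟩ := h
      obtain ⟨A, hAB, hA⟩ := ih B (hBT.ssubset_of_ne hne) hBn hB0
      exact ⟨A, hAB.trans hBT, hA⟩
    · push Not at h
      refine ⟨T, subset_rfl, hT, h0, fun B hB hB0 => ?_⟩
      rcases B.eq_empty_or_nonempty with h1 | h1
      · exact Or.inl h1
      · exact Or.inr (h B hB hB0 h1)

/-- Induction on the blocks, with `T.card + D.toFinset.card` as potential. A block padded with `v`
while `T` or `D` is nonempty uses at most `2 * e` copies of `v` and lowers the potential by at least
one, which preserves the last inequality. -/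
theorem Realizes.blocks {ι : Type*} [DecidableEq ι] {v : V} (hv : v ≠ 0) {e : ℕ} (he : 0 < e)
    {X : ι → Finset V} (hXcard : ∀ c, (X c).card = 4 * e) (C : Finset ι) :
    ∀ (T : Finset V) (D : Multiset V) (m : ℕ),
      (∀ c, ∀ x ∈ X c, x + v ∈ X c) →
      (∀ s ∈ T, s ≠ 0 ∧ ∀ c, ∀ x ∈ X c, x + s ∈ X c) →
      (∀ s ∈ D, s ≠ 0 ∧ s ≠ v ∧ ∀ c, ∀ x ∈ X c, x + s ∈ X c) →
      (∀ s, Even (D.count s)) → ∑ s ∈ T, (s + v) = 0 →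
      T.card + Multiset.card D + m = C.card * (2 * e) →
      (T.card + D.toFinset.card) * (2 * e) ≤ m →
      Realizes (∑ c ∈ C, (X c).val) (T.val + D + Multiset.replicate m v) := by
  induction C using Finset.induction_on with
  | empty =>
    intro T D m _ _ _ _ _ hcard _
    rw [Finset.card_empty, zero_mul] at hcard
    obtain rfl : T = ∅ := Finset.card_eq_zero.1 (by omega)
    obtain rfl : D = 0 := Multiset.card_eq_zero.1 (by omega)
    obtain rfl : m = 0 := by omega
    simpa using Realizes.zero
  | insert c C hc ih =>
    intro T D m hXv hT hD heven hsum hcard hm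
    rw [Finset.card_insert_of_notMem hc, add_mul, one_mul] at hcard
    rw [Finset.sum_insert hc]
    rcases T.eq_empty_or_nonempty with rfl | hTn
    · rcases eq_or_ne D 0 with rfl | hDn
      · simp only [Finset.card_empty, Multiset.card_zero, zero_add] at hcard
        have h1 := ih ∅ 0 (m - 2 * e) hXv (by simp) (by simp) (by simp) (by simp)
          (by simp; omega) (by simp)
        have h2 := Realizes.replicate_of_invariant hv (2 * e) (X c) (hXv c)
          (by rw [hXcard]; omega)
        have := h2.add h1
        simpa [← Multiset.replicate_add, show 2 * e + (m - 2 * e) = m by omega] using this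
      · obtain ⟨u, hu⟩ := Multiset.exists_mem_of_ne_zero hDn
        obtain ⟨hu0, huv, hXu⟩ := hD u hu
        simp only [Finset.card_empty, zero_add] at hcard hm
        -- With at least `2 * e` copies of `u` the block is filled by `u` alone and no `v` is spent;
        -- otherwise all copies of `u` go into this block and `u` leaves the support.
        by_cases hbig : 2 * e ≤ D.count u
        · obtain ⟨D', rfl⟩ := Multiset.le_iff_exists_add.1 (Multiset.le_count_iff_replicate_le.1 hbig)
          have h1 := ih ∅ D' m hXv (by simp)
            (fun s hs => hD s (Multiset.mem_add.2 (Or.inr hs)))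
            (fun s => by
              have := heven s
              rw [Multiset.count_add, Multiset.count_replicate] at this
              refine (Nat.even_add.1 this).1 ?_
              split_ifs <;> simp) (by simp)
            (by
              simp only [Multiset.card_add, Multiset.card_replicate] at hcard
              simp; omega)
            (by
              refine le_trans (Nat.mul_le_mul_right _ ?_) hm
              simp only [Finset.card_empty, zero_add]
              exact Finset.card_le_card (Multiset.toFinset_subset.2 (Multiset.subset_of_le
                (Multiset.le_add_left _ _))))
          have h2 := Realizes.replicate_of_invariant hu0 (2 * e) (X c) (hXu c)
            (by rw [hXcard]; omega)
          have := h2.add h1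
          rw [Finset.empty_val, zero_add, ← add_assoc] at this
          rwa [Finset.empty_val, zero_add]
        · obtain ⟨r, hr⟩ := heven u
          set D' := D.filter (· ≠ u) with hD'
          have hDD : Multiset.replicate (2 * r) u + D' = D := by
            rw [hD', two_mul, ← hr, ← Multiset.filter_eq']
            exact Multiset.filter_add_not _ _
          have hcd : 2 * r + Multiset.card D' = Multiset.card D := by
            rw [← hDD]; simp
          have htf : D'.toFinset.card + 1 ≤ D.toFinset.card := by
            have : D'.toFinset ⊆ D.toFinset.erase u := by
              intro x hx
              rw [Multiset.mem_toFinset, hD', Multiset.mem_filter] at hx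
              simp [hx.1, hx.2]
            have h3 := Finset.card_le_card this
            have hu' : u ∈ D.toFinset := by simpa using hu
            rw [Finset.card_erase_of_mem hu'] at h3
            have := Finset.card_pos.2 ⟨u, hu'⟩
            omega
          have hm2 : D'.toFinset.card * (2 * e) + 2 * e ≤ m := by
            refine le_trans ?_ hm
            rw [← Nat.succ_mul]
            exact Nat.mul_le_mul_right _ htf
          have h1 := ih ∅ D' (m - (2 * (e - r))) hXv (by simp)
            (fun s hs => hD s (Multiset.mem_of_mem_filter hs))
            (fun s => by
              rw [hD', Multiset.count_filter]
              split_ifs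
              · exact heven s
              · exact Even.zero) (by simp)
            (by simp only [Finset.card_empty, zero_add]; omega)
            (by simp only [Finset.card_empty, zero_add]; omega)
          have h2 := Realizes.replicate_add_replicate_of_invariant hu0 hv huv r (e - r) (X c)
            (hXu c) (hXv c) (by rw [hXcard]; omega)
          have := h2.add h1
          rw [Finset.empty_val, zero_add, add_add_add_comm, hDD, ← Multiset.replicate_add,
            Nat.add_sub_cancel' (by omega)] at this
          rwa [Finset.empty_val, zero_add]
    · obtain ⟨A, hAT, hAn, hA0, hmin⟩ := exists_minimal_sum_eq_zero (fun s => s + v) hTn hsum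
      have hXn : (X c).Nonempty := Finset.card_pos.1 (by rw [hXcard]; omega)
      obtain ⟨hle, h2⟩ := Realizes.of_minimal hv (fun h => (hT 0 (hAT h)).1 rfl) hA0 hmin hXn
        (hXv c) (fun s hs => (hT s (hAT hs)).2 c) (k := 2 * e) (by rw [hXcard]; omega)
      have hAc := Finset.card_pos.2 hAn
      have hTA := Finset.card_sdiff_add_card_eq_card hAT
      have hm2 : ((T \ A).card + D.toFinset.card) * (2 * e) + 2 * e ≤ m := by
        refine le_trans ?_ hm
        rw [← Nat.succ_mul]
        exact Nat.mul_le_mul_right _ (by omega)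
      have h1 := ih (T \ A) D (m - (2 * e - A.card)) hXv
        (fun s hs => hT s (Finset.sdiff_subset hs)) hD heven
        (by
          have := Finset.sum_sdiff (f := fun s => s + v) hAT
          rwa [hsum, hA0, add_zero] at this)
        (by omega) (by omega)
      have := h2.add h1
      rw [add_add_add_comm, ← Multiset.replicate_add, Nat.add_sub_cancel' (by omega), ← add_assoc,
        Finset.sdiff_val, add_tsub_cancel_of_le (Finset.val_le_iff.2 hAT)] at this
      exact this

end Blocks

theorem Submodule.card_fiber_mkQ {V : Type*} [AddCommGroup V] [Module (ZMod 2) V] [Fintype V]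
    (W : Submodule (ZMod 2) V) [DecidableEq (V ⧸ W)] (c : V ⧸ W) :
    (Finset.univ.filter fun x => W.mkQ x = c).card = Nat.card W := by
  classical
  obtain ⟨y, rfl⟩ := W.mkQ_surjective c
  rw [← Fintype.card_subtype, ← Nat.card_eq_fintype_card]
  refine Nat.card_congr ⟨fun x => ⟨x.1 - y, ?_⟩, fun w => ⟨w.1 + y, ?_⟩, ?_, ?_⟩
  · have := x.2
    rwa [← sub_eq_zero, ← map_sub, ← LinearMap.mem_ker, Submodule.ker_mkQ] at this
  · simp
  · intro x; exact Subtype.ext (sub_add_cancel _ _)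
  · intro w; simp

/-! ### Cosets of the span and the choice of `v` -/

section Main

variable {V : Type*} [AddCommGroup V] [Module (ZMod 2) V] [DecidableEq V]

theorem Multiset.sum_eq_zero_of_even_count {D : Multiset V} (h : ∀ s, Even (D.count s)) :
    D.sum = 0 := by
  rw [Finset.sum_multiset_count]
  refine Finset.sum_eq_zero fun s _ => ?_
  obtain ⟨r, hr⟩ := h s
  rw [hr, add_nsmul, ZModModule.add_self]

theorem Multiset.even_card_of_even_count {α : Type*} [DecidableEq α] {D : Multiset α}
    (h : ∀ s, Even (D.count s)) : Even (Multiset.card D) := by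
  rw [← Multiset.toFinset_sum_count_eq]
  exact Finset.even_sum _ fun s _ => h s

theorem Realizes.univ_of_submodule [Fintype V] (W : Submodule (ZMod 2) V) {D : Multiset V} {v : V}
    {e : ℕ} (he : 0 < e) (hW : Nat.card W = 4 * e) (hD0 : (0 : V) ∉ D) (hDW : ∀ s ∈ D, s ∈ W)
    (hvD : v ∈ D) (hsum : D.sum = 0) (hcard : Fintype.card V = 2 * Multiset.card D)
    (hcount : 2 * D.toFinset.card * (2 * e) ≤ D.count v) :
    Realizes Finset.univ.val D := by
  classical
  set X : V ⧸ W → Finset V := fun c => Finset.univ.filter fun x => W.mkQ x = c with hX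
  have hXcard : ∀ c, (X c).card = 4 * e := fun c => by rw [hX, W.card_fiber_mkQ, hW]
  have hXW : ∀ s ∈ W, ∀ c, ∀ x ∈ X c, x + s ∈ X c := by
    intro s hs c x hx
    simp only [hX, Finset.mem_filter, Finset.mem_univ, true_and, map_add] at hx ⊢
    have : W.mkQ s = 0 := by simpa using hs
    rw [hx, this, add_zero]
  have huniv : ∑ c, (X c).val = (Finset.univ : Finset V).val := by
    ext x
    have h1 : ∀ c, Multiset.count x (X c).val = if W.mkQ x = c then 1 else 0 := by
      intro c
      rw [Multiset.count_eq_of_nodup (X c).nodup]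
      simp only [Finset.mem_val, hX, Finset.mem_filter, Finset.mem_univ, true_and]
    rw [Multiset.count_sum', Finset.sum_congr rfl fun c _ => h1 c,
      Multiset.count_eq_of_nodup Finset.univ.nodup, Finset.sum_ite_eq]
    simp
  have hVcard : Fintype.card V = Fintype.card (V ⧸ W) * (4 * e) := by
    rw [← Finset.card_univ, Finset.card_def, ← huniv, Multiset.card_sum]
    simp [hXcard]
  have hDcard : Multiset.card D = Fintype.card (V ⧸ W) * (2 * e) := by
    have : Fintype.card (V ⧸ W) * (4 * e) = 2 * (Fintype.card (V ⧸ W) * (2 * e)) := by ring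
    omega
  set T := D.toFinset.filter fun s => s ≠ v ∧ Odd (D.count s) with hT
  have hTle : T.val ≤ D.filter (· ≠ v) := by
    rw [Multiset.le_iff_count]
    intro s
    rw [Multiset.count_eq_of_nodup T.nodup]
    split_ifs with h
    · rw [Finset.mem_val, hT, Finset.mem_filter, Multiset.mem_toFinset] at h
      rw [Multiset.count_filter, if_pos h.2.1]
      exact Multiset.one_le_count_iff_mem.2 h.1
    · exact Nat.zero_le _
  set E := D.filter (· ≠ v) - T.val with hE
  have hTE : T.val + E = D.filter (· ≠ v) := add_tsub_cancel_of_le hTle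
  have hED : ∀ s ∈ E, s ∈ D ∧ s ≠ v := fun s hs =>
    Multiset.mem_filter.1 (Multiset.mem_of_le tsub_le_self hs)
  have hall : T.val + E + Multiset.replicate (D.count v) v = D := by
    rw [hTE, ← Multiset.filter_eq', add_comm]
    exact Multiset.filter_add_not _ _
  have heven : ∀ s, Even (E.count s) := by
    intro s
    rw [hE, Multiset.count_sub, Multiset.count_eq_of_nodup T.nodup, Multiset.count_filter]
    by_cases hsv : s = v
    · simp [hsv]
    · rw [if_pos hsv]
      rcases Nat.even_or_odd (D.count s) with h | h
      · have : s ∉ T := by simp [hT, Nat.not_odd_iff_even.2 h]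
        simpa only [Finset.mem_val, this, if_false, Nat.sub_zero] using h
      · have hs : s ∈ D := Multiset.count_pos.1 h.pos
        have : s ∈ T := by simp [hT, h, hs, hsv]
        simp only [Finset.mem_val, this, if_true]
        exact Nat.Odd.sub_odd h odd_one
  have hcards := congrArg Multiset.card hall
  rw [Multiset.card_add, Multiset.card_add, Multiset.card_replicate, Finset.card_val] at hcards
  -- Even multiplicities contribute nothing, so `T` sums to `D.count v • v`. As `D` and `E` have
  -- even size, `T.card` has the parity of `D.count v`, and the two multiples of `v` cancel.
  have hTsum : ∑ s ∈ T, (s + v) = 0 := by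
    have h1 := congrArg Multiset.sum hall
    rw [Multiset.sum_add, Multiset.sum_add, Multiset.sum_eq_zero_of_even_count heven, hsum,
      Multiset.sum_replicate, add_zero] at h1
    obtain ⟨a, ha⟩ := Multiset.even_card_of_even_count heven
    have hDeven : Even (Multiset.card D) := by
      rw [hDcard]
      exact (even_two_mul e).mul_left _
    rw [Nat.even_iff] at hDeven
    have hpar : Even (T.card + D.count v) := by
      rw [Nat.even_iff]; omega
    obtain ⟨b, hb⟩ := hpar
    have h2 : T.card • v + D.count v • v = 0 := by
      rw [← add_nsmul, hb, add_nsmul, ZModModule.add_self]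
    rw [← ZModModule.sub_eq_add, sub_eq_zero] at h2
    rw [Finset.sum_add_distrib, Finset.sum_const, h2, Finset.sum_eq_multiset_sum, Multiset.map_id']
    exact h1
  have hTD : T.card ≤ D.toFinset.card := Finset.card_le_card (Finset.filter_subset _ _)
  have hEDc : E.toFinset.card ≤ D.toFinset.card :=
    Finset.card_le_card (Multiset.toFinset_subset.2 fun s hs => (hED s hs).1)
  have ne0 : ∀ s ∈ D, s ≠ 0 := by
    rintro s hs rfl
    exact hD0 hs
  have := Realizes.blocks (ne0 v hvD) he hXcard Finset.univ T E (D.count v)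
    (hXW v (hDW v hvD))
    (fun s hs => by
      have hs : s ∈ D := Multiset.mem_toFinset.1 (Finset.mem_filter.1 hs).1
      exact ⟨ne0 s hs, hXW s (hDW s hs)⟩)
    (fun s hs => ⟨ne0 s (hED s hs).1, (hED s hs).2, hXW s (hDW s (hED s hs).1)⟩)
    heven hTsum
    (by rw [hcards, Finset.card_univ, hDcard])
    (le_trans (Nat.mul_le_mul_right _ (by omega)) hcount)
  rwa [huniv, hall] at this

theorem Realizes.univ_of_card_le [Fintype V] {D : Multiset V} (hD0 : (0 : V) ∉ D) (hsum : D.sum = 0)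
    (hcard : Fintype.card V = 2 * Multiset.card D)
    (ht : 2 * D.toFinset.card ^ 2 * 2 ^ D.toFinset.card ≤ Fintype.card V) :
    Realizes Finset.univ.val D := by
  set t := D.toFinset.card with htdef
  have hDn : D.toFinset.Nonempty := by
    rw [Multiset.toFinset_nonempty]
    rintro rfl
    have := Fintype.card_pos (α := V)
    simp at hcard
  have htpos : 0 < t := Finset.card_pos.2 hDn
  obtain ⟨v, hv, hvc⟩ : ∃ v ∈ D.toFinset, t * 2 ^ t ≤ D.count v := by
    refine Finset.exists_le_of_sum_le hDn ?_
    rw [Multiset.toFinset_sum_count_eq, Finset.sum_const, smul_eq_mul, ← htdef]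
    nlinarith
  rw [Multiset.mem_toFinset] at hv
  have hv0 : v ≠ 0 := by rintro rfl; exact hD0 hv
  -- A single value spans only a line, whose order is not divisible by 4, so it is treated apart.
  by_cases hone : ∀ u ∈ D, u = v
  · rw [Multiset.eq_replicate_card.2 hone]
    exact Realizes.replicate_of_invariant hv0 _ _ (by simp) (by simpa using hcard)
  push Not at hone
  obtain ⟨u, hu, huv⟩ := hone
  have hu0 : u ≠ 0 := by rintro rfl; exact hD0 hu
  set W := Submodule.span (ZMod 2) (D.toFinset : Set V) with hWdef
  have hDW : ∀ s ∈ D, s ∈ W := fun s hs => Submodule.subset_span (by simpa using hs)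
  have hWc : Nat.card W = 2 ^ Module.finrank (ZMod 2) W := by
    simpa using Module.natCard_eq_pow_finrank (K := ZMod 2) (V := W)
  have hfin : Module.finrank (ZMod 2) W ≤ t := finrank_span_finset_le_card _
  have : Fintype W := Fintype.ofFinite W
  have h3 : 2 < Nat.card W := by
    have h := Finset.card_le_card (Finset.subset_univ
      ({0, ⟨u, hDW u hu⟩, ⟨v, hDW v hv⟩} : Finset W))
    rw [Finset.card_insert_of_notMem (by simp [Subtype.ext_iff, hu0.symm, hv0.symm]),
      Finset.card_pair (by simpa [Subtype.ext_iff] using huv), Finset.card_univ,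
      ← Nat.card_eq_fintype_card] at h
    exact h
  obtain ⟨r, hr⟩ : ∃ r, Module.finrank (ZMod 2) W = r + 2 := by
    refine ⟨Module.finrank (ZMod 2) W - 2, ?_⟩
    have : 1 < Module.finrank (ZMod 2) W := by
      refine (Nat.pow_lt_pow_iff_right (a := 2) one_lt_two).1 ?_
      rwa [← hWc, pow_one]
    omega
  refine Realizes.univ_of_submodule W (v := v) (e := 2 ^ r) (by positivity)
    (by rw [hWc, hr, pow_add]; ring) hD0 hDW hv hsum hcard (le_trans ?_ hvc)
  -- With `4 * e = Nat.card W ≤ 2 ^ t`, the required `2 * t * (2 * e)` copies are at most `t * 2 ^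
  -- t`.
  have : 2 ^ (r + 2) ≤ 2 ^ t := Nat.pow_le_pow_right two_pos (hr ▸ hfin)
  rw [pow_add] at this
  rw [← htdef]
  nlinarith

end Main

theorem two_mul_sq_mul_two_pow_le {n t : ℕ} (hn : 2 ≤ n)
    (ht : (t : ℝ) ≤ (n : ℝ) - 2 * Real.logb 2 (n : ℝ) - 1) :
    2 * t ^ 2 * 2 ^ t ≤ 2 ^ n := by
  have hn0 : (0 : ℝ) < n := by positivity
  have hlog : 0 ≤ Real.logb 2 (n : ℝ) :=
    Real.logb_nonneg one_lt_two (by exact_mod_cast (by omega : 1 ≤ n))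
  have htn : (t : ℝ) ≤ n := by linarith
  -- Exponentiating the hypothesis gives `2 ^ t * 2 * n ^ 2 ≤ 2 ^ n`; then `t ≤ n` replaces `n ^ 2`
  -- by `t ^ 2`.
  have h1 : (2 : ℝ) ^ ((t : ℝ) + 1 + 2 * Real.logb 2 (n : ℝ)) ≤ 2 ^ (n : ℝ) :=
    Real.rpow_le_rpow_of_exponent_le one_le_two (by linarith)
  rw [Real.rpow_add two_pos, Real.rpow_add two_pos, mul_comm (2 : ℝ) (Real.logb 2 n),
    Real.rpow_mul two_pos.le, Real.rpow_logb two_pos (by norm_num) hn0] at h1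
  norm_cast at h1
  have h2 : t ≤ n := by exact_mod_cast htn
  calc 2 * t ^ 2 * 2 ^ t ≤ 2 * n ^ 2 * 2 ^ t := by gcongr
    _ = 2 ^ t * 2 * n ^ 2 := by ring
    _ ≤ 2 ^ n := by simpa [pow_succ] using h1

theorem mainTheorem1 (n : ℕ) (hn : 2 ≤ n)
    (d : Fin (2 ^ (n - 1)) → (Fin n → ZMod 2))
    (hd : ∀ i, d i ≠ 0) (hsum : ∑ i, d i = 0)
    (ht : ((Set.range d).ncard : ℝ) ≤ (n : ℝ) - 2 * Real.logb 2 (n : ℝ) - 1) :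
    ∃ a b : Fin (2 ^ (n - 1)) → (Fin n → ZMod 2),
      (∀ i j, i ≠ j →
        Disjoint ({a i, b i} : Set (Fin n → ZMod 2)) ({a j, b j} : Set (Fin n → ZMod 2))) ∧
      (⋃ i, ({a i, b i} : Set (Fin n → ZMod 2))) = Set.univ ∧
      (∀ i, a i - b i = d i) := by
  have hV : Fintype.card (Fin n → ZMod 2) = 2 ^ n := by simp
  have hrange : (Set.range d).ncard = (Finset.univ.val.map d).toFinset.card := by
    rw [← Set.ncard_coe_finset]
    congr 1
    ext x
    simp
  have hR : Realizes Finset.univ.val (Finset.univ.val.map d) := by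
    refine Realizes.univ_of_card_le (by simpa using hd) hsum ?_ ?_
    · rw [hV, Multiset.card_map, Finset.card_val, Finset.card_univ, Fintype.card_fin, ← pow_succ',
        Nat.sub_add_cancel (by omega)]
    · rw [hV, ← hrange]
      exact two_mul_sq_mul_two_pow_le hn ht
  obtain ⟨a, b, hab, hdiff⟩ := hR.exists_pairing
  have hnd := (Finset.univ : Finset (Fin n → ZMod 2)).nodup
  rw [← hab, Multiset.nodup_add] at hnd
  obtain ⟨ha, hb, hdis⟩ := hnd
  have hainj : Function.Injective a := fun i j h =>
    Multiset.inj_on_of_nodup_map ha i (by simp) j (by simp) h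
  have hbinj : Function.Injective b := fun i j h =>
    Multiset.inj_on_of_nodup_map hb i (by simp) j (by simp) h
  have hne : ∀ i j, a i ≠ b j := fun i j h =>
    Multiset.disjoint_left.1 hdis (Multiset.mem_map_of_mem a (Finset.mem_univ_val i))
      (h ▸ Multiset.mem_map_of_mem b (Finset.mem_univ_val j))
  refine ⟨a, b, fun i j hij => ?_, ?_, hdiff⟩
  · simp [Set.disjoint_left, hainj.ne hij, hbinj.ne hij, hne i j, (hne j i).symm]
  · ext x
    have : x ∈ (Finset.univ : Finset (Fin n → ZMod 2)).val := by simp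
    rw [← hab] at this
    simp only [Multiset.mem_add, Multiset.mem_map, Finset.mem_val, Finset.mem_univ, true_and] at this
    simp only [Set.mem_iUnion, Set.mem_insert_iff, Set.mem_singleton_iff, Set.mem_univ, iff_true]
    rcases this with ⟨i, hi⟩ | ⟨i, hi⟩
    · exact ⟨i, Or.inl hi.symm⟩
    · exact ⟨i, Or.inr hi.symm⟩
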